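/- Let $h=\prod_{i=1}^{t}p_i^{s_i}$ with $t\ge 1$, $p_1,\dots,p_t$ distinct primes and all $s_i\ge 1$, and let $\mathbb{Z}_h=\mathbb{Z}/h\mathbb{Z}$. Vectors $v_1,\dots,v_k\in\mathbb{Z}_h^n$ are called unimodular if the $k\times n$ matrix with rows $v_1,\dots,v_k$ has a right inverse. For a $\mathbb{Z}_h$-submodule $V\subseteq\mathbb{Z}_h^n$, let $\dim V$ be the largest number of vectors in a unimodular family contained in $V$. An $m$-subspace of $\mathbb{Z}_h^n$ is a submodule that has a unimodular basis with $m$ vectors. The generalized Grassmann graph $G_r(m,n,\mathbb{Z}_h)$ has all $m$-subspaces of $\mathbb{Z}_h^n$ as its vertices, and two distinct vertices $A,B$ are adjacent if and only if $\dim(A\cap B)>m-r$. Let $\alpha(\Gamma)$ denote the independence number of a graph $\Gamma$, that is, the largest number of pairwise non-adjacent vertices. If $n>m\ge 2$ and $m\mid n$, then $$\alpha(G_m(m,n,\mathbb{Z}_h))=\prod_{i=1}^{t}p_i^{(s_i-1)(n-m)}\,\frac{p_i^{n}-1}{p_i^{m}-1}.$$ Moreover, let the subspace distance be $d(A,B)=\dim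 A+\dim B-2\dim(A\cap B)$, and let an $(n,2m,m)_{\mathbb{Z}_h}$ code be a set of $m$-subspaces of $\mathbb{Z}_h^n$ whose minimum subspace distance between distinct members is $2m$. Then optimal $(n,2m,m)_{\mathbb{Z}_h}$ codes, i.e. those of maximum cardinality, exist, and each of them has exactly $\prod_{i=1}^{t}p_i^{(s_i-1)(n-m)}(p_i^{n}-1)/(p_i^{m}-1)$ elements. -/

import Mathlib

namespace ResidueGrassmann

/-- A finite family of row vectors `v 0, …, v (k-1)` in `R^n` is unimodular if the `k × n` matrix
with these rows has a right inverse. -/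
def IsUnimodular {R : Type*} [CommRing R] {n k : ℕ} (v : Fin k → (Fin n → R)) : Prop :=
  ∃ B : Matrix (Fin n) (Fin k) R, Matrix.of v * B = 1

/-- The vectors of a unimodular family are linearly independent. -/
theorem IsUnimodular.linearIndependent {R : Type*} [CommRing R] {n k : ℕ}
    {v : Fin k → (Fin n → R)} (hv : IsUnimodular v) : LinearIndependent R v := by
  obtain ⟨B, hB⟩ := hv
  rw [Fintype.linearIndependent_iff]
  intro g hg
  have h1 : Matrix.vecMul g (Matrix.of v) = 0 := by
    rw [← hg]
    ext j
    simp [Matrix.vecMul, dotProduct, Finset.sum_apply]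
  have h2 : g = 0 := by
    rw [← Matrix.vecMul_one g, ← hB, ← Matrix.vecMul_vecMul, h1, Matrix.zero_vecMul]
  exact fun i => congrFun h2 i

/-- The dimension of a linear subset `V` of `R^n`: the largest number of vectors in a unimodular
family contained in `V`. (Over a nontrivial ring a unimodular family consists of at most `n`
distinct vectors, so that this is a maximum.) -/
noncomputable def dim {R : Type*} [CommRing R] {n : ℕ} (V : Submodule R (Fin n → R)) : ℕ :=
  sSup {k : ℕ | ∃ v : Fin k → (Fin n → R), (∀ i, v i ∈ V) ∧ IsUnimodular v}

/-- `X` is an `m`-subspace of `R^n`: it has a unimodular basis with `m` vectors. The linear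
independence of the basis follows from unimodularity. -/
def IsSubspace {R : Type*} [CommRing R] {n : ℕ} (m : ℕ) (X : Submodule R (Fin n → R)) : Prop :=
  ∃ v : Fin m → (Fin n → R), IsUnimodular v ∧ Submodule.span R (Set.range v) = X

/-- The set of all `m`-subspaces of `R^n`. -/
abbrev Subspaces (R : Type*) [CommRing R] (m n : ℕ) : Type _ :=
  {X : Submodule R (Fin n → R) // IsSubspace m X}

/-- The generalized Grassmann graph `G_r(m, n, ℤ_h)`: its vertices are the `m`-subspaces of
`ℤ_h^n`, and two distinct vertices are adjacent if their intersection has dimension `> m - r`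
(written without subtraction). -/
def grassmannGraph (r m n h : ℕ) : SimpleGraph (Subspaces (ZMod h) m n) where
  Adj A B := A ≠ B ∧ m < dim (A.1 ⊓ B.1) + r
  symm := ⟨fun A B hAB => ⟨hAB.1.symm, by rw [inf_comm]; exact hAB.2⟩⟩
  loopless := ⟨fun _ hA => hA.1 rfl⟩

/-- The subspace distance `dim A + dim B - 2 dim (A ∩ B)`. -/
noncomputable def subspaceDist {R : Type*} [CommRing R] {n : ℕ}
    (A B : Submodule R (Fin n → R)) : ℤ :=
  (dim A : ℤ) + (dim B : ℤ) - 2 * (dim (A ⊓ B) : ℤ)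

/-- An `(n, d, m)` code for `ℤ_h^n`: a set of `m`-subspaces of `ℤ_h^n` whose minimum subspace
distance (over pairs of distinct members) is exactly `d`. -/
def IsCode (n d m h : ℕ) (C : Finset (Subspaces (ZMod h) m n)) : Prop :=
  IsLeast {δ : ℤ | ∃ A ∈ C, ∃ B ∈ C, A ≠ B ∧ δ = subspaceDist A.1 B.1} (d : ℤ)

/-- An optimal `(n, d, m)` code: one of maximum cardinality. -/
def IsOptimalCode (n d m h : ℕ) (C : Finset (Subspaces (ZMod h) m n)) : Prop :=
  IsCode n d m h C ∧ ∀ C' : Finset (Subspaces (ZMod h) m n), IsCode n d m h C' → C'.card ≤ C.card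

end ResidueGrassmann

namespace ResidueGrassmann

/-! For `r = m`, independent sets and distance-`2m` codes are families of `m`-subspaces whose
pairwise intersections have dimension zero, i.e. contain no unimodular vector. Every `m`-subspace
contains the same number `U m` of unimodular vectors, so such a family has at most `U n / U m`
members (`card_mul_unimodularCount_le`), with equality when it covers all unimodular vectors. The
Chinese remainder theorem and a count over each local ring `ZMod (p ^ s)` turn this ratio into the
stated product.

The bound is attained by an analogue of the Desarguesian spread. Let `S = ℤ_h[X]/(G)`, with `G`
monic of degree `m` and irreducible modulo each `p i`. Then `S` is free of rank `m`, and for `n = m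
* k` the `S`-lines of `S ^ k ≃ ℤ_h ^ n` through unimodular vectors form the required family
(`exists_spread_zmod`). -/

/-- A vector is unimodular if it has a right inverse for the dot product. -/
def IsUnimodularVec {R : Type*} [CommRing R] {n : ℕ} (v : Fin n → R) : Prop :=
  ∃ w : Fin n → R, v ⬝ᵥ w = 1

/-- The number of unimodular vectors of `R^n`. -/
noncomputable def unimodularCount (R : Type*) [CommRing R] (n : ℕ) : ℕ :=
  Nat.card {v : Fin n → R // IsUnimodularVec v}

/-! ### Unimodular vectors in `m`-subspaces and the packing bound -/

theorem isUnimodularVec_vecMul_iff {R : Type*} [CommRing R] {n m : ℕ}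
    {M : Matrix (Fin m) (Fin n) R} {B : Matrix (Fin n) (Fin m) R} (hMB : M * B = 1)
    (c : Fin m → R) : IsUnimodularVec (Matrix.vecMul c M) ↔ IsUnimodularVec c := by
  constructor
  · rintro ⟨w, hw⟩
    exact ⟨Matrix.mulVec M w, by rw [Matrix.dotProduct_mulVec, hw]⟩
  · rintro ⟨w, hw⟩
    refine ⟨Matrix.mulVec B w, ?_⟩
    rw [Matrix.dotProduct_mulVec, Matrix.vecMul_vecMul, hMB, Matrix.vecMul_one, hw]

theorem vecMul_of_eq_sum {R : Type*} [CommRing R] {n m : ℕ} (v : Fin m → Fin n → R)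
    (c : Fin m → R) : Matrix.vecMul c (Matrix.of v) = ∑ i, c i • v i := by
  ext j
  simp [Matrix.vecMul, dotProduct, Finset.sum_apply]

theorem IsUnimodular.isUnimodularVec {R : Type*} [CommRing R] {n k : ℕ}
    {v : Fin k → Fin n → R} (hv : IsUnimodular v) (i : Fin k) : IsUnimodularVec (v i) := by
  obtain ⟨B, hB⟩ := hv
  refine ⟨fun j => B j i, ?_⟩
  have := congrFun (congrFun hB i) i
  rwa [Matrix.one_apply_eq] at this

/-- An `m`-subspace has as many unimodular vectors as `R^m`. -/
theorem IsSubspace.natCard_unimodular {R : Type*} [CommRing R] {n m : ℕ}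
    {X : Submodule R (Fin n → R)} (hX : IsSubspace m X) :
    Nat.card {v : Fin n → R // v ∈ X ∧ IsUnimodularVec v} = unimodularCount R m := by
  obtain ⟨v, ⟨B, hB⟩, rfl⟩ := hX
  refine (Nat.card_congr (Equiv.ofBijective
    (fun c : {c : Fin m → R // IsUnimodularVec c} =>
      (⟨Matrix.vecMul c.1 (Matrix.of v), ?_, ?_⟩ :
        {w : Fin n → R // w ∈ Submodule.span R (Set.range v) ∧ IsUnimodularVec w})) ⟨?_, ?_⟩)).symm
  · rw [vecMul_of_eq_sum]
    exact Submodule.sum_mem _ fun i _ =>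
      Submodule.smul_mem _ _ (Submodule.subset_span ⟨i, rfl⟩)
  · exact (isUnimodularVec_vecMul_iff hB _).2 c.2
  · rintro ⟨c, hc⟩ ⟨d, hd⟩ hcd
    have h1 : Matrix.vecMul c (Matrix.of v) = Matrix.vecMul d (Matrix.of v) :=
      congrArg Subtype.val hcd
    have h2 := congrArg (fun w => Matrix.vecMul w B) h1
    simp only [Matrix.vecMul_vecMul, hB, Matrix.vecMul_one] at h2
    exact Subtype.ext h2
  · rintro ⟨w, hw, hw'⟩
    obtain ⟨c, rfl⟩ := (Submodule.mem_span_range_iff_exists_fun R).1 hw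
    rw [← vecMul_of_eq_sum, isUnimodularVec_vecMul_iff hB] at hw'
    exact ⟨⟨c, hw'⟩, Subtype.ext (vecMul_of_eq_sum v c)⟩

theorem bddAbove_unimodular {R : Type*} [CommRing R] [Nontrivial R] {n : ℕ}
    (V : Submodule R (Fin n → R)) :
    BddAbove {k : ℕ | ∃ v : Fin k → (Fin n → R), (∀ i, v i ∈ V) ∧ IsUnimodular v} := by
  refine ⟨n, ?_⟩
  rintro k ⟨v, -, hv⟩
  simpa using hv.linearIndependent.fintype_card_le_finrank

theorem dim_eq_zero_iff {R : Type*} [CommRing R] [Nontrivial R] {n : ℕ}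
    (V : Submodule R (Fin n → R)) : dim V = 0 ↔ ∀ v ∈ V, ¬ IsUnimodularVec v := by
  constructor
  · rintro h v hv ⟨w, hw⟩
    have h1 : 1 ≤ dim V := by
      refine le_csSup (bddAbove_unimodular V)
        ⟨fun _ => v, fun _ => hv, Matrix.of fun i _ => w i, ?_⟩
      ext i j
      rw [Subsingleton.elim i j, Matrix.one_apply_eq]
      exact hw
    omega
  · intro h
    refine Nat.le_zero.1 (csSup_le ⟨0, Fin.elim0, fun i => i.elim0, 0, ?_⟩ ?_)
    · ext i
      exact i.elim0
    · rintro k ⟨v, hv, hu⟩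
      by_contra hk
      exact h _ (hv ⟨0, by omega⟩) (hu.isUnimodularVec _)

theorem IsSubspace.dim_eq {R : Type*} [CommRing R] [Nontrivial R] {n m : ℕ}
    {X : Submodule R (Fin n → R)} (hX : IsSubspace m X) : dim X = m := by
  obtain ⟨v, hv, rfl⟩ := hX
  refine le_antisymm (csSup_le ⟨m, v, fun i => Submodule.subset_span ⟨i, rfl⟩, hv⟩ ?_)
    (le_csSup (bddAbove_unimodular _) ⟨v, fun i => Submodule.subset_span ⟨i, rfl⟩, hv⟩)
  rintro k ⟨w, hw, hu⟩
  let b := Module.Basis.span hv.linearIndependent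
  have hli : LinearIndependent R
      (fun i => (⟨w i, hw i⟩ : Submodule.span R (Set.range v))) :=
    LinearIndependent.of_comp (Submodule.span R (Set.range v)).subtype hu.linearIndependent
  have := Module.Finite.of_basis b
  have := hli.fintype_card_le_finrank
  rwa [Module.finrank_eq_card_basis b, Fintype.card_fin, Fintype.card_fin] at this

/-- Zero-dimensional intersections make the sets of unimodular vectors of the members disjoint, so
their sizes add. -/
theorem card_mul_unimodularCount {R : Type*} [CommRing R] [Nontrivial R] [Finite R] {m n : ℕ}
    (C : Finset (Subspaces R m n))
    (hC : ∀ A ∈ C, ∀ B ∈ C, A ≠ B → dim (A.1 ⊓ B.1) = 0) :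
    C.card * unimodularCount R m =
      Nat.card {v : Fin n → R // (∃ A ∈ C, v ∈ A.1) ∧ IsUnimodularVec v} := by
  have h1 : ∀ A : C, Nat.card {v : Fin n → R // v ∈ A.1.1 ∧ IsUnimodularVec v} =
      unimodularCount R m := fun A => A.1.2.natCard_unimodular
  have h2 : Nat.card (Σ A : C, {v : Fin n → R // v ∈ A.1.1 ∧ IsUnimodularVec v}) =
      C.card * unimodularCount R m := by
    rw [Nat.card_sigma]
    simp [h1]
  rw [← h2]
  refine Nat.card_congr (Equiv.ofBijective
    (fun x => ⟨x.2.1, ⟨x.1.1, x.1.2, x.2.2.1⟩, x.2.2.2⟩) ⟨?_, ?_⟩)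
  · rintro ⟨⟨A, hA⟩, v, hvA, hv⟩ ⟨⟨B, hB⟩, w, hwB, hw⟩ hvw
    obtain rfl : v = w := congrArg Subtype.val hvw
    by_cases hAB : A = B
    · subst hAB
      rfl
    · exact absurd hv ((dim_eq_zero_iff _).1 (hC A hA B hB hAB) v ⟨hvA, hwB⟩)
  · rintro ⟨v, ⟨A, hA, hvA⟩, hv⟩
    exact ⟨⟨⟨A, hA⟩, v, hvA, hv⟩, rfl⟩

theorem card_mul_unimodularCount_le {R : Type*} [CommRing R] [Nontrivial R] [Finite R] {m n : ℕ}
    (C : Finset (Subspaces R m n))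
    (hC : ∀ A ∈ C, ∀ B ∈ C, A ≠ B → dim (A.1 ⊓ B.1) = 0) :
    C.card * unimodularCount R m ≤ unimodularCount R n := by
  rw [card_mul_unimodularCount C hC]
  exact Nat.card_le_card_of_injective (fun v => ⟨v.1, v.2.2⟩)
    fun v w h => Subtype.ext (Subtype.mk.inj h)

theorem card_mul_unimodularCount_eq {R : Type*} [CommRing R] [Nontrivial R] [Finite R] {m n : ℕ}
    (C : Finset (Subspaces R m n))
    (hC : ∀ A ∈ C, ∀ B ∈ C, A ≠ B → dim (A.1 ⊓ B.1) = 0)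
    (hcover : ∀ v : Fin n → R, IsUnimodularVec v → ∃ A ∈ C, v ∈ A.1) :
    C.card * unimodularCount R m = unimodularCount R n := by
  rw [card_mul_unimodularCount C hC]
  exact Nat.card_congr (Equiv.subtypeEquivRight fun v => ⟨fun h => h.2, fun h => ⟨hcover v h, h⟩⟩)


/-! ### Counting unimodular vectors over `ℤ_h` -/

theorem unimodularCount_pi {ι : Type*} [Fintype ι] (S : ι → Type*) [∀ i, CommRing (S i)]
    (n : ℕ) : unimodularCount (∀ i, S i) n = ∏ i, unimodularCount (S i) n := by
  unfold unimodularCount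
  rw [← Nat.card_pi]
  have key : ∀ v : Fin n → ∀ i, S i,
      IsUnimodularVec v ↔ ∀ i, IsUnimodularVec (fun j => v j i) := by
    intro v
    constructor
    · rintro ⟨w, hw⟩ i
      refine ⟨fun j => w j i, ?_⟩
      simpa [dotProduct] using congrFun hw i
    · intro h
      choose w hw using h
      refine ⟨fun j i => w i j, ?_⟩
      ext i
      simpa [dotProduct] using hw i
  exact Nat.card_congr
    { toFun := fun v i => ⟨fun j => v.1 j i, (key v.1).1 v.2 i⟩
      invFun := fun v => ⟨fun j i => (v i).1 j, (key _).2 fun i => (v i).2⟩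
      left_inv := fun _ => rfl
      right_inv := fun _ => rfl }

theorem unimodularCount_congr {R S : Type*} [CommRing R] [CommRing S] (e : R ≃+* S) (n : ℕ) :
    unimodularCount R n = unimodularCount S n := by
  refine Nat.card_congr ((Equiv.arrowCongr (Equiv.refl _) e.toEquiv).subtypeEquiv fun v => ?_)
  constructor
  · rintro ⟨w, hw⟩
    refine ⟨fun j => e (w j), ?_⟩
    simpa [dotProduct] using congrArg e hw
  · rintro ⟨w, hw⟩
    refine ⟨fun j => e.symm (w j), ?_⟩
    simpa [dotProduct] using congrArg e.symm hw

theorem isUnimodularVec_iff_exists_isUnit {R : Type*} [CommRing R] [IsLocalRing R] {n : ℕ}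
    (v : Fin n → R) : IsUnimodularVec v ↔ ∃ i, IsUnit (v i) := by
  constructor
  · rintro ⟨w, hw⟩
    by_contra! h
    have h1 : v ⬝ᵥ w ∈ IsLocalRing.maximalIdeal R :=
      Ideal.sum_mem _ fun i _ => Ideal.mul_mem_right _ _ (h i)
    rw [hw] at h1
    exact h1 isUnit_one
  · rintro ⟨i, hi⟩
    obtain ⟨b, hb⟩ := hi.exists_right_inv
    exact ⟨Pi.single i b, by rw [dotProduct_single, hb]⟩

/-- Over a local ring the non-unimodular vectors are those with all coordinates nonunits. -/
theorem unimodularCount_add_of_isLocalRing {R : Type*} [CommRing R] [IsLocalRing R] [Finite R]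
    (n : ℕ) : unimodularCount R n + Nat.card (nonunits R) ^ n = Nat.card R ^ n := by
  have h1 : Nat.card {v : Fin n → R // ¬ IsUnimodularVec v} = Nat.card (nonunits R) ^ n := by
    have h2 : Nat.card (Fin n → nonunits R) = Nat.card (nonunits R) ^ n := by
      rw [Nat.card_fun, Nat.card_fin]
    rw [← h2]
    refine Nat.card_congr ((Equiv.subtypeEquivRight fun v => ?_).trans
      (Equiv.subtypePiEquivPi (p := fun _ a => a ∈ nonunits R)))
    rw [isUnimodularVec_iff_exists_isUnit]
    simp [mem_nonunits_iff]
  classical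
  have := Fintype.ofFinite R
  have h3 : Nat.card (Fin n → R) = Nat.card R ^ n := by
    rw [Nat.card_fun, Nat.card_fin]
  rw [← h1, ← h3, unimodularCount, ← Nat.card_sum]
  exact Nat.card_congr (Equiv.sumCompl _)

theorem natCard_nonunits_add (R : Type*) [CommRing R] [Finite R] :
    Nat.card (nonunits R) + Nat.card Rˣ = Nat.card R := by
  have h1 : Nat.card Rˣ = Nat.card {a : R // IsUnit a} :=
    Nat.card_congr (Equiv.ofBijective (fun u => ⟨u, u.isUnit⟩)
      ⟨fun u v h => Units.ext (congrArg Subtype.val h), fun ⟨a, u, hu⟩ => ⟨u, Subtype.ext hu⟩⟩)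
  classical
  rw [h1, add_comm, ← Nat.card_congr (Equiv.sumCompl (fun a : R => IsUnit a)), Nat.card_sum]
  rfl

theorem isLocalRing_zmod_prime_pow {p s : ℕ} (hp : p.Prime) (hs : 1 ≤ s) :
    IsLocalRing (ZMod (p ^ s)) := by
  have : Fact (1 < p ^ s) := ⟨Nat.one_lt_pow (by omega) hp.one_lt⟩
  have key : ∀ a : ZMod (p ^ s), a ∈ nonunits _ ↔ p ∣ a.val := by
    intro a
    rw [mem_nonunits_iff, ← ZMod.natCast_zmod_val a, ZMod.isUnit_iff_coprime, ZMod.natCast_zmod_val,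
      Nat.coprime_pow_right_iff (by omega), Nat.coprime_comm, hp.coprime_iff_not_dvd, not_not]
  refine IsLocalRing.of_nonunits_add fun a b ha hb => ?_
  rw [key] at ha hb ⊢
  rw [ZMod.val_add, Nat.dvd_mod_iff (dvd_pow_self p (by omega))]
  exact dvd_add ha hb

theorem unimodularCount_zmod_prime_pow {p s : ℕ} (hp : p.Prime) (hs : 1 ≤ s) (n : ℕ) :
    (unimodularCount (ZMod (p ^ s)) n : ℚ) = (p : ℚ) ^ ((s - 1) * n) * ((p : ℚ) ^ n - 1) := by
  have := isLocalRing_zmod_prime_pow hp hs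
  have : NeZero (p ^ s) := ⟨(pow_pos hp.pos s).ne'⟩
  have h1 := natCard_nonunits_add (ZMod (p ^ s))
  have h2 := unimodularCount_add_of_isLocalRing (R := ZMod (p ^ s)) n
  rw [Nat.card_eq_fintype_card (α := (ZMod (p ^ s))ˣ), ZMod.card_units_eq_totient,
    Nat.totient_prime_pow hp (by omega), Nat.card_zmod] at h1
  have h3 : Nat.card (nonunits (ZMod (p ^ s))) = p ^ (s - 1) := by
    obtain ⟨q, rfl⟩ : ∃ q, p = q + 1 := ⟨p - 1, by have := hp.pos; omega⟩
    obtain ⟨r, rfl⟩ : ∃ r, s = r + 1 := ⟨s - 1, by omega⟩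
    simp only [Nat.add_sub_cancel] at h1 ⊢
    have h4 : (q + 1) ^ (r + 1) = (q + 1) ^ r * q + (q + 1) ^ r := by ring
    omega
  rw [h3, Nat.card_zmod] at h2
  obtain ⟨r, rfl⟩ : ∃ r, s = r + 1 := ⟨s - 1, by omega⟩
  simp only [Nat.add_sub_cancel] at h2 ⊢
  have h4 : (unimodularCount (ZMod (p ^ (r + 1))) n : ℚ) + ((p : ℚ) ^ r) ^ n =
      ((p : ℚ) ^ (r + 1)) ^ n := by exact_mod_cast h2
  rw [pow_succ (p : ℚ), mul_pow, ← pow_mul] at h4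
  linear_combination h4

theorem unimodularCount_zmod_prod {ι : Type*} [Fintype ι] {p s : ι → ℕ}
    (hp : ∀ i, (p i).Prime) (hpinj : Function.Injective p) (hs : ∀ i, 1 ≤ s i) (n : ℕ) :
    (unimodularCount (ZMod (∏ i, p i ^ s i)) n : ℚ) =
      ∏ i, (p i : ℚ) ^ ((s i - 1) * n) * ((p i : ℚ) ^ n - 1) := by
  have hco : Pairwise (Function.onFun Nat.Coprime fun i => p i ^ s i) := fun i j hij =>
    Nat.Coprime.pow _ _ ((Nat.coprime_primes (hp i) (hp j)).2 (hpinj.ne hij))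
  rw [unimodularCount_congr (ZMod.prodEquivPi _ hco), unimodularCount_pi, Nat.cast_prod]
  exact Finset.prod_congr rfl fun i _ => unimodularCount_zmod_prime_pow (hp i) (hs i) n


/-! ### Spreads from lines over an extension ring -/

section Line

variable {R S : Type*} [CommRing R] [CommRing S] [Algebra R S] {k m n : ℕ}

/-- The image in `R^n` of the `S`-line through `x`, under an `R`-linear identification of `S^k`
with `R^n`. -/
def line (e : (Fin k → S) ≃ₗ[R] (Fin n → R)) (x : Fin k → S) : Submodule R (Fin n → R) :=
  LinearMap.range (e.toLinearMap ∘ₗ (LinearMap.toSpanSingleton S (Fin k → S) x).restrictScalars R)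

theorem mem_line {e : (Fin k → S) ≃ₗ[R] (Fin n → R)} {x : Fin k → S} {v : Fin n → R} :
    v ∈ line e x ↔ ∃ a : S, e (a • x) = v := by
  simp [line]

theorem isSubspace_line (b : Module.Basis (Fin m) R S) (e : (Fin k → S) ≃ₗ[R] (Fin n → R))
    {x : Fin k → S} (hx : IsUnimodularVec x) : IsSubspace m (line e x) := by
  obtain ⟨w, hw⟩ := hx
  refine ⟨fun i => e (b i • x), ?_, ?_⟩
  · let φ : (Fin n → R) →ₗ[R] S :=
      { toFun := fun y => e.symm y ⬝ᵥ w
        map_add' := fun y z => by rw [map_add, add_dotProduct]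
        map_smul' := fun r y => by rw [map_smul, smul_dotProduct, RingHom.id_apply] }
    -- The columns of the right inverse are the `b`-coordinates of `φ`, which sends `e (a • x)` to
    -- `a`.
    refine ⟨Matrix.of fun l j => b.repr (φ (Pi.single l 1)) j, ?_⟩
    ext i j
    have h1 : φ (e (b i • x)) = b i := by
      change e.symm (e (b i • x)) ⬝ᵥ w = b i
      rw [LinearEquiv.symm_apply_apply, smul_dotProduct, hw, smul_eq_mul, mul_one]
    have h2 : ∀ y : Fin n → R,
        b.repr (φ y) j = ∑ l, y l * b.repr (φ (Pi.single l 1)) j := by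
      intro y
      conv_lhs => rw [pi_eq_sum_univ' y]
      simp [map_sum, Finsupp.finsetSum_apply]
    rw [Matrix.mul_apply]
    refine (h2 (e (b i • x))).symm.trans ?_
    rw [h1, b.repr_self, Matrix.one_apply, Finsupp.single_apply]
  · have : (Set.range fun i => e (b i • x)) =
        (e.toLinearMap ∘ₗ (LinearMap.toSpanSingleton S (Fin k → S) x).restrictScalars R) ''
          Set.range b := by
      rw [← Set.range_comp]
      rfl
    rw [this, ← Submodule.map_span, b.span_eq, Submodule.map_top]
    rfl

/-- If `a • x` is unimodular then `a` is a unit of `S`, so `x` and `a • x` span the same line. -/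
theorem line_eq_of_mem {e : (Fin k → S) ≃ₗ[R] (Fin n → R)} {x : Fin k → S} {v : Fin n → R}
    (hv : v ∈ line e x) (hu : IsUnimodularVec (e.symm v)) : line e x = line e (e.symm v) := by
  obtain ⟨a, rfl⟩ := mem_line.1 hv
  obtain ⟨w, hw⟩ := hu
  rw [LinearEquiv.symm_apply_apply, smul_dotProduct, smul_eq_mul] at hw
  rw [LinearEquiv.symm_apply_apply]
  ext y
  rw [mem_line, mem_line]
  constructor
  · rintro ⟨c, rfl⟩
    refine ⟨c * (x ⬝ᵥ w), ?_⟩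
    rw [smul_smul, mul_assoc, mul_comm _ a, hw, mul_one]
  · rintro ⟨c, rfl⟩
    exact ⟨c * a, by rw [smul_smul]⟩

/-- If the `S`-coordinates generated a proper ideal, they would lie in a maximal ideal and share a
nonunit factor `r` from `R`. By `R`-linearity `r` would divide `v`, which is then not unimodular. -/
theorem isUnimodularVec_symm (e : (Fin k → S) ≃ₗ[R] (Fin n → R))
    (hS : ∀ M : Ideal S, M.IsMaximal → ∃ r : R, ¬ IsUnit r ∧ ∀ a ∈ M, algebraMap R S r ∣ a)
    {v : Fin n → R} (hv : IsUnimodularVec v) : IsUnimodularVec (e.symm v) := by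
  by_cases htop : Ideal.span (Set.range (e.symm v)) = ⊤
  · obtain ⟨c, hc⟩ := Ideal.mem_span_range_iff_exists_fun.1 ((Ideal.eq_top_iff_one _).1 htop)
    exact ⟨c, by rw [dotProduct_comm]; exact hc⟩
  · obtain ⟨M, hM, hle⟩ := Ideal.exists_le_maximal _ htop
    obtain ⟨r, hr, hdvd⟩ := hS M hM
    choose y hy using fun i => hdvd _ (hle (Ideal.subset_span ⟨i, rfl⟩))
    have h1 : e.symm v = r • y := by
      ext i
      rw [hy, Pi.smul_apply, Algebra.smul_def]
    have h2 : v = r • e y := by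
      rw [← map_smul, ← h1, LinearEquiv.apply_symm_apply]
    obtain ⟨w, hw⟩ := hv
    rw [h2, smul_dotProduct, smul_eq_mul] at hw
    exact absurd (IsUnit.of_mul_eq_one _ hw) hr

/-- The `S`-lines form a spread of `m`-subspaces of `R^n`. -/
theorem exists_spread [Nontrivial R] [Finite R] (b : Module.Basis (Fin m) R S)
    (e : (Fin k → S) ≃ₗ[R] (Fin n → R))
    (hS : ∀ M : Ideal S, M.IsMaximal → ∃ r : R, ¬ IsUnit r ∧ ∀ a ∈ M, algebraMap R S r ∣ a) :
    ∃ C : Finset (Subspaces R m n),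
      (∀ A ∈ C, ∀ B ∈ C, A ≠ B → dim (A.1 ⊓ B.1) = 0) ∧
      ∀ v : Fin n → R, IsUnimodularVec v → ∃ A ∈ C, v ∈ A.1 := by
  have hfin : {X : Subspaces R m n | ∃ x, IsUnimodularVec x ∧ X.1 = line e x}.Finite :=
    Set.toFinite _
  refine ⟨hfin.toFinset, ?_, ?_⟩
  · intro A hA B hB hAB
    rw [Set.Finite.mem_toFinset] at hA hB
    obtain ⟨x, -, hAx⟩ := hA
    obtain ⟨y, -, hBy⟩ := hB
    rw [dim_eq_zero_iff]
    rintro v ⟨hvA, hvB⟩ hv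
    have hv' := isUnimodularVec_symm e hS hv
    rw [SetLike.mem_coe, hAx] at hvA
    rw [SetLike.mem_coe, hBy] at hvB
    refine hAB (Subtype.ext ?_)
    rw [hAx, hBy, line_eq_of_mem hvA hv', line_eq_of_mem hvB hv']
  · intro v hv
    have hv' := isUnimodularVec_symm e hS hv
    refine ⟨⟨line e (e.symm v), isSubspace_line b e hv'⟩, ?_, ?_⟩
    · rw [Set.Finite.mem_toFinset]
      exact ⟨_, hv', rfl⟩
    · exact mem_line.2 ⟨1, by rw [one_smul, LinearEquiv.apply_symm_apply]⟩

end Line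

/-! ### The extension `ℤ_h[X]/(G)` -/

open Polynomial

theorem exists_monic_irreducible_natDegree {p m : ℕ} [Fact p.Prime] (hm : m ≠ 0) :
    ∃ f : (ZMod p)[X], f.Monic ∧ f.natDegree = m ∧ Irreducible f := by
  obtain ⟨α, hα⟩ := Field.exists_primitive_element (ZMod p) (GaloisField p m)
  have hint : IsIntegral (ZMod p) α := Algebra.IsIntegral.isIntegral α
  refine ⟨minpoly (ZMod p) α, minpoly.monic hint, ?_, minpoly.irreducible hint⟩
  rw [(Field.primitive_element_iff_minpoly_natDegree_eq _ α).1 hα, GaloisField.finrank p hm]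

theorem exists_natCast_eq {ι : Type*} [Fintype ι] {p : ι → ℕ} (hp : ∀ i, (p i).Prime)
    (hpinj : Function.Injective p) (a : ∀ i, ZMod (p i)) : ∃ c : ℕ, ∀ i, (c : ZMod (p i)) = a i := by
  have hco : Pairwise (Function.onFun Nat.Coprime p) := fun i j hij =>
    (Nat.coprime_primes (hp i) (hp j)).2 (hpinj.ne hij)
  have : NeZero (∏ i, p i) := ⟨Finset.prod_ne_zero_iff.2 fun i _ => (hp i).ne_zero⟩
  obtain ⟨x, hx⟩ := (ZMod.prodEquivPi p hco).surjective a
  refine ⟨x.val, fun i => ?_⟩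
  have := congrFun hx i
  rw [← ZMod.natCast_zmod_val x, map_natCast] at this
  simpa using this

/-- Coefficients are glued by the Chinese remainder theorem. Lifting to `ℕ[X]` lets one polynomial
reduce both to `ZMod h` and to every `ZMod (p i)`. -/
theorem exists_monic_lift {ι : Type*} [Fintype ι] {p : ι → ℕ} (hp : ∀ i, (p i).Prime)
    (hpinj : Function.Injective p) {m : ℕ} (f : ∀ i, (ZMod (p i))[X]) (hf : ∀ i, (f i).Monic)
    (hdeg : ∀ i, (f i).natDegree = m) :
    ∃ F : ℕ[X], F.Monic ∧ F.natDegree = m ∧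
      ∀ i, F.map (Nat.castRingHom (ZMod (p i))) = f i := by
  choose c hc using fun j => exists_natCast_eq hp hpinj fun i => (f i).coeff j
  have hlt : (∑ j ∈ Finset.range m, C (c j) * X ^ j : ℕ[X]).degree < (m : WithBot ℕ) := by
    refine (degree_sum_le _ _).trans_lt ((Finset.sup_lt_iff (WithBot.bot_lt_coe m)).2 fun j hj => ?_)
    exact (degree_C_mul_X_pow_le _ _).trans_lt (WithBot.coe_lt_coe.2 (Finset.mem_range.1 hj))
  refine ⟨X ^ m + ∑ j ∈ Finset.range m, C (c j) * X ^ j, monic_X_pow_add hlt, ?_, fun i => ?_⟩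
  · refine natDegree_eq_of_degree_eq_some ?_
    rw [degree_add_eq_left_of_degree_lt (by rwa [degree_X_pow]), degree_X_pow]
  · rw [(hf i).as_sum, hdeg i]
    simp [Polynomial.map_sum, ← hc]

theorem natCast_dvd_of_castHom_eq_zero {p h : ℕ} [NeZero h] (hph : p ∣ h) {a : ZMod h}
    (ha : ZMod.castHom hph (ZMod p) a = 0) : (p : ZMod h) ∣ a := by
  rw [← ZMod.natCast_zmod_val a, map_natCast, ZMod.natCast_eq_zero_iff] at ha
  rw [← ZMod.natCast_zmod_val a]
  exact_mod_cast Nat.cast_dvd_cast ha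

theorem natCast_dvd_of_map_eq_zero {p h : ℕ} [NeZero h] (hph : p ∣ h) {g : (ZMod h)[X]}
    (hg : g.map (ZMod.castHom hph (ZMod p)) = 0) : (p : (ZMod h)[X]) ∣ g := by
  have : (p : (ZMod h)[X]) = C (p : ZMod h) := by simp
  rw [this, C_dvd_iff_dvd_coeff]
  intro i
  refine natCast_dvd_of_castHom_eq_zero hph ?_
  rw [← coeff_map, hg, coeff_zero]

/-- A prime ideal of `(ℤ/h)[X]/(f)` over `p` is generated by `p` if `f` is irreducible mod `p`. -/
theorem natCast_dvd_of_mem {p h : ℕ} [NeZero h] [Fact p.Prime] (hph : p ∣ h) {f : (ZMod h)[X]}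
    (hf : Irreducible (f.map (ZMod.castHom hph (ZMod p)))) {M : Ideal (AdjoinRoot f)}
    (hM : M ≠ ⊤) (hpM : (p : AdjoinRoot f) ∈ M) {a : AdjoinRoot f} (ha : a ∈ M) :
    (p : AdjoinRoot f) ∣ a := by
  obtain ⟨g, rfl⟩ := AdjoinRoot.mk_surjective a
  have hsurj : Function.Surjective (Polynomial.map (ZMod.castHom hph (ZMod p))) :=
    Polynomial.map_surjective _ (ZMod.castHom_surjective hph)
  have key : ∀ q : (ZMod h)[X], q.map (ZMod.castHom hph (ZMod p)) = 0 →
      (p : AdjoinRoot f) ∣ AdjoinRoot.mk f q := by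
    intro q hq
    simpa using map_dvd (AdjoinRoot.mk f) (natCast_dvd_of_map_eq_zero hph hq)
  -- Modulo `p`, either `f` divides `g`, giving the claim, or a Bézout relation puts `1` in `M`.
  rcases (dvd_or_isCoprime _ (g.map (ZMod.castHom hph (ZMod p))) hf) with ⟨q, hq⟩ | ⟨u, w, huw⟩
  · obtain ⟨q, rfl⟩ := hsurj q
    have := key (g - f * q) (by rw [Polynomial.map_sub, Polynomial.map_mul, hq, sub_self])
    simpa using this
  · obtain ⟨u, rfl⟩ := hsurj u
    obtain ⟨w, rfl⟩ := hsurj w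
    have := key (u * f + w * g - 1) (by simp [huw])
    have h1 : AdjoinRoot.mk f (u * f + w * g - 1) ∈ M := Ideal.mem_of_dvd M this hpM
    refine absurd ((Ideal.eq_top_iff_one M).2 ?_) hM
    have h2 : (1 : AdjoinRoot f) =
        AdjoinRoot.mk f w * AdjoinRoot.mk f g - AdjoinRoot.mk f (u * f + w * g - 1) := by
      simp
    rw [h2]
    exact M.sub_mem (M.mul_mem_left _ ha) h1

theorem exists_spread_zmod {ι : Type*} [Fintype ι] {p s : ι → ℕ} (hp : ∀ i, (p i).Prime)
    (hpinj : Function.Injective p) (hs : ∀ i, 1 ≤ s i) {h : ℕ} (hh : h = ∏ i, p i ^ s i)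
    (h1 : 1 < h) {m n : ℕ} (hm : m ≠ 0) (hdvd : m ∣ n) :
    ∃ C : Finset (Subspaces (ZMod h) m n),
      (∀ A ∈ C, ∀ B ∈ C, A ≠ B → dim (A.1 ⊓ B.1) = 0) ∧
      ∀ v : Fin n → ZMod h, IsUnimodularVec v → ∃ A ∈ C, v ∈ A.1 := by
  have : Fact (1 < h) := ⟨h1⟩
  have : NeZero h := ⟨by omega⟩
  have hph : ∀ i, p i ∣ h := fun i => hh ▸
    (dvd_pow_self _ (Nat.one_le_iff_ne_zero.1 (hs i))).trans
      (Finset.dvd_prod_of_mem (fun i => p i ^ s i) (Finset.mem_univ i))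
  have hirr : ∀ i, ∃ f : (ZMod (p i))[X], f.Monic ∧ f.natDegree = m ∧ Irreducible f := fun i =>
    have : Fact (p i).Prime := ⟨hp i⟩
    exists_monic_irreducible_natDegree hm
  choose f hmon hdeg hirr using hirr
  obtain ⟨F, hF, hFdeg, hFmap⟩ := exists_monic_lift hp hpinj f hmon hdeg
  let G : (ZMod h)[X] := F.map (Nat.castRingHom (ZMod h))
  have hG : G.Monic := hF.map _
  have hGdeg : G.natDegree = m := (hF.natDegree_map _).trans hFdeg
  have hGmap : ∀ i, G.map (ZMod.castHom (hph i) (ZMod (p i))) = f i := by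
    intro i
    rw [← hFmap i, Polynomial.map_map]
    exact congrArg (fun φ => F.map φ) (Subsingleton.elim _ _)
  let b : Module.Basis (Fin m) (ZMod h) (AdjoinRoot G) :=
    (AdjoinRoot.powerBasis' hG).basis.reindex (finCongr hGdeg)
  obtain ⟨k, rfl⟩ := hdvd
  have := Module.Free.of_basis b
  have := Module.Finite.of_basis b
  let e : (Fin k → AdjoinRoot G) ≃ₗ[ZMod h] (Fin (m * k) → ZMod h) :=
    LinearEquiv.ofFinrankEq _ _ (by
      rw [Module.finrank_pi_fintype]
      simp [Module.finrank_eq_card_basis b, mul_comm])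
  refine exists_spread b e fun M hM => ?_
  -- Since `h = 0` in the extension, the prime ideal `M` contains some `p i`, which serves as the
  -- nonunit divisor.
  have h0 : ((∏ i, p i ^ s i : ℕ) : AdjoinRoot G) ∈ M := by
    rw [← hh]
    have : (h : AdjoinRoot G) = 0 := by
      rw [← map_natCast (algebraMap (ZMod h) (AdjoinRoot G)), ZMod.natCast_self, map_zero]
    rw [this]
    exact M.zero_mem
  rw [Nat.cast_prod, hM.isPrime.prod_mem_iff] at h0
  obtain ⟨i, -, hi⟩ := h0
  rw [Nat.cast_pow] at hi
  have hi := hM.isPrime.mem_of_pow_mem _ hi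
  have : Fact (p i).Prime := ⟨hp i⟩
  refine ⟨(p i : ZMod h), fun hu => ?_, fun a ha => ?_⟩
  · have := hu.map (ZMod.castHom (hph i) (ZMod (p i)))
    rw [map_natCast, ZMod.natCast_self] at this
    exact not_isUnit_zero this
  · rw [map_natCast]
    exact natCast_dvd_of_mem (hph i) (by rw [hGmap]; exact hirr i) hM.ne_top hi ha

end ResidueGrassmann

/-! ### The independence number and optimal codes -/

theorem theorem5p6 (t : ℕ) (ht : 1 ≤ t) (p s : Fin t → ℕ)
    (hp : ∀ i, (p i).Prime) (hpinj : Function.Injective p) (hs : ∀ i, 1 ≤ s i)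
    (h : ℕ) (hh : h = ∏ i, p i ^ s i)
    (m n : ℕ) (hm : 2 ≤ m) (hmn : m < n) (hdvd : m ∣ n) :
    ((ResidueGrassmann.grassmannGraph m m n h).indepNum : ℚ) =
        ∏ i, (p i : ℚ) ^ ((s i - 1) * (n - m)) * (((p i : ℚ) ^ n - 1) / ((p i : ℚ) ^ m - 1)) ∧
    (∃ C, ResidueGrassmann.IsOptimalCode n (2 * m) m h C) ∧
    (∀ C, ResidueGrassmann.IsOptimalCode n (2 * m) m h C →
      (C.card : ℚ) =
        ∏ i, (p i : ℚ) ^ ((s i - 1) * (n - m)) *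
          (((p i : ℚ) ^ n - 1) / ((p i : ℚ) ^ m - 1))) := by
  open ResidueGrassmann in
  have h1 : 1 < h := by
    have hdvd : p ⟨0, ht⟩ ∣ h := hh ▸ (dvd_pow_self _ (Nat.one_le_iff_ne_zero.1 (hs _))).trans
      (Finset.dvd_prod_of_mem (fun i => p i ^ s i) (Finset.mem_univ _))
    have hpos : 0 < h := hh ▸ Finset.prod_pos fun i _ => pow_pos (hp i).pos _
    exact (hp _).one_lt.trans_le (Nat.le_of_dvd hpos hdvd)
  have : Fact (1 < h) := ⟨h1⟩
  have : NeZero h := ⟨by omega⟩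
  have hcount : ∀ k, (unimodularCount (ZMod h) k : ℚ) =
      ∏ i, (p i : ℚ) ^ ((s i - 1) * k) * ((p i : ℚ) ^ k - 1) := by
    subst hh
    exact unimodularCount_zmod_prod hp hpinj hs
  have hpone : ∀ i, (1 : ℚ) < p i := fun i => by exact_mod_cast (hp i).one_lt
  have hsub : ∀ i k, k ≠ 0 → (0 : ℚ) < (p i : ℚ) ^ k - 1 := fun i k hk =>
    sub_pos.2 (one_lt_pow₀ (hpone i) hk)
  have hpos : (0 : ℚ) < unimodularCount (ZMod h) m := by
    rw [hcount]
    exact Finset.prod_pos fun i _ =>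
      mul_pos (pow_pos (zero_lt_one.trans (hpone i)) _) (hsub i m (by omega))
  have hlt : (unimodularCount (ZMod h) m : ℚ) < unimodularCount (ZMod h) n := by
    rw [hcount, hcount]
    refine Finset.prod_lt_prod_of_nonempty (fun i _ =>
      mul_pos (pow_pos (zero_lt_one.trans (hpone i)) _) (hsub i m (by omega))) (fun i _ => ?_)
      ⟨⟨0, ht⟩, Finset.mem_univ _⟩
    refine mul_lt_mul' (pow_le_pow_right₀ (hpone i).le (Nat.mul_le_mul_left _ hmn.le))
      (sub_lt_sub_right (pow_lt_pow_right₀ (hpone i) hmn) _) (hsub i m (by omega)).le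
      (pow_pos (zero_lt_one.trans (hpone i)) _)
  have hratio : ∏ i, (p i : ℚ) ^ ((s i - 1) * (n - m)) *
      (((p i : ℚ) ^ n - 1) / ((p i : ℚ) ^ m - 1)) =
      (unimodularCount (ZMod h) n : ℚ) / unimodularCount (ZMod h) m := by
    rw [hcount, hcount, ← Finset.prod_div_distrib]
    refine Finset.prod_congr rfl fun i _ => ?_
    have hne := (hsub i m (by omega)).ne'
    have hne' : (p i : ℚ) ≠ 0 := (zero_lt_one.trans (hpone i)).ne'
    obtain ⟨d, rfl⟩ := Nat.exists_eq_add_of_le hmn.le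
    rw [Nat.add_sub_cancel_left, mul_add, pow_add (p i : ℚ) ((s i - 1) * m)]
    field_simp
  obtain ⟨C, hCdim, hCcover⟩ := exists_spread_zmod hp hpinj hs hh h1 (by omega : m ≠ 0) hdvd
  have hCcount := card_mul_unimodularCount_eq C hCdim hCcover
  have hCcard : (C.card : ℚ) = ∏ i, (p i : ℚ) ^ ((s i - 1) * (n - m)) *
      (((p i : ℚ) ^ n - 1) / ((p i : ℚ) ^ m - 1)) := by
    rw [hratio, eq_div_iff hpos.ne']
    exact_mod_cast hCcount
  have hupper : ∀ D : Finset (Subspaces (ZMod h) m n),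
      (∀ A ∈ D, ∀ B ∈ D, A ≠ B → dim (A.1 ⊓ B.1) = 0) → D.card ≤ C.card := by
    intro D hD
    have := card_mul_unimodularCount_le D hD
    rw [← hCcount] at this
    exact Nat.le_of_mul_le_mul_right this (by exact_mod_cast hpos)
  have hdist : ∀ A B : Subspaces (ZMod h) m n,
      subspaceDist A.1 B.1 = 2 * m - 2 * (dim (A.1 ⊓ B.1) : ℤ) := by
    intro A B
    rw [subspaceDist, A.2.dim_eq, B.2.dim_eq]
    ring
  have hcode : ∀ D, IsCode n (2 * m) m h D → D.card ≤ C.card := by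
    intro D hD
    refine hupper D fun A hA B hB hAB => ?_
    have := hD.2 ⟨A, hA, B, hB, hAB, rfl⟩
    rw [hdist] at this
    push_cast at this
    omega
  have hCcode : IsCode n (2 * m) m h C := by
    -- A code must attain its minimum distance, so two distinct members are needed; they exist
    -- because `U m < U n`.
    have hone : 1 < C.card := by
      by_contra! hle
      have := Nat.mul_le_mul_right (unimodularCount (ZMod h) m) hle
      rw [hCcount, one_mul] at this
      exact absurd hlt (not_lt.2 (by exact_mod_cast this))
    obtain ⟨A, hA, B, hB, hAB⟩ := Finset.one_lt_card.1 hone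
    refine ⟨⟨A, hA, B, hB, hAB, ?_⟩, ?_⟩
    · rw [hdist, hCdim A hA B hB hAB]
      push_cast
      ring
    · rintro δ ⟨A, hA, B, hB, hAB, rfl⟩
      rw [hdist, hCdim A hA B hB hAB]
      push_cast
      omega
  refine ⟨?_, ⟨C, hCcode, hcode⟩, fun D hD => ?_⟩
  · rw [← hCcard]
    congr 1
    -- With `r = m`, distinct vertices are adjacent exactly when their intersection has positive
    -- dimension.
    refine le_antisymm ?_ (SimpleGraph.IsIndepSet.card_le_indepNum fun A hA B hB hAB hadj => ?_)
    · obtain ⟨D, hD, hDcard⟩ := (grassmannGraph m m n h).exists_isNIndepSet_indepNum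
      rw [← hDcard]
      refine hupper D fun A hA B hB hAB => ?_
      have := hD hA hB hAB
      simp only [grassmannGraph, not_and, not_lt] at this
      have := this hAB
      omega
    · have := hadj.2
      rw [hCdim A hA B hB hAB] at this
      omega
  · rw [← hCcard, le_antisymm (hcode D hD.1) (hD.2 C hCcode)]
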